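/- Let $\mathcal A_n=\mathbb R[\partial_1^{\pm1},\dots,\partial_n^{\pm1}]$ be the real Laurent polynomial ring, acting on trajectories $v:\mathbb Z^n\to\mathbb R$ by shifts, $(\partial^{\mu}v)(\nu)=v(\nu+\mu)$, and let matrices over $\mathcal A_n$ act on vector-valued trajectories accordingly; for $d\le n$ regard $\mathcal A_d=\mathbb R[\partial_1^{\pm1},\dots,\partial_d^{\pm1}]$ as a subring of $\mathcal A_n$. Let $R\in\mathcal A_n^{m\times \mathtt w}$, let $\mathfrak B=\ker R=\{v:\mathbb Z^n\to\mathbb R^{\mathtt w}\mid Rv=0\}$, let $\mathcal R\subseteq\mathcal A_n^{\mathtt w}$ be the submodule spanned by the rows of $R$ (the equation module), and suppose that $\mathfrak B$ is autonomous, i.e. the ideal of $\mathcal A_n$ generated by the $\mathtt w\times\mathtt w$ minors of $R$ is nonzero (this ideal is zero by convention if $m<\mathtt w$). Let $d$ be the Krull dimension of $\mathcal A_n/\operatorname{ann}(\mathcal A_n^{\mathtt w}/\mathcal R)$, where $d:=0$ by convention if $\mathcal A_n^{\mathtt w}/\mathcal R=0$. Then $d\le n$, and there exist a matrix $T\in\mathbb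 Z^{n\times n}$ with $\det T=\pm1$, integers $\gamma\ge1$ and $k\ge 0$, and matrices $X\in\mathcal A_d^{k\times\gamma}$, $A_1,\dots,A_{n-d}\in\mathcal A_d^{\gamma\times\gamma}$ and $C\in\mathcal A_d^{\mathtt w\times\gamma}$ such that, writing $(\Phi_T w)(\nu)=w(T\nu)$ and $\mathcal X=\{x:\mathbb Z^d\to\mathbb R^\gamma\mid Xx=0\}$, both of the following representations hold. 1. (First-order representation.) $\mathfrak B$ is the set of all $v=\Phi_T(w)$, where $w:\mathbb Z^n\to\mathbb R^{\mathtt w}$ is such that there exists $\mathbf x:\mathbb Z^{n-d}\to\mathcal X$ with $$\mathbf x(\nu+e_j)=A_j\,\mathbf x(\nu)\qquad(\nu\in\mathbb Z^{n-d},\ 1\le j\le n-d)$$ and $w=C\mathbf x$, that is, $w(\nu_1,\dots,\nu_n)=\bigl(C\,\mathbf x(\nu_{d+1},\dots,\nu_n)\bigr)(\nu_1,\dots,\nu_d)$ for all $(\nu_1,\dots,\nu_n)\in\mathbb Z^n$. Here $e_j$ is the $j$-th standard basis vector. 2. (Latent-variable representation.) $\mathfrak B$ is the set of all $v=\Phi_T(w)$,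 where $w:\mathbb Z^n\to\mathbb R^{\mathtt w}$ is such that there exists $\mathbf x:\mathbb Z^{n}\to\mathbb R^\gamma$ with $$\begin{bmatrix}X&0\\ \partial_{d+1}I_\gamma-A_1&0\\ \vdots&\vdots\\ \partial_nI_\gamma-A_{n-d}&0\\ -C&I_{\mathtt w}\end{bmatrix}\begin{bmatrix}\mathbf x\\ w\end{bmatrix}=0 .$$ -/

import Mathlib

noncomputable section

namespace NDSystem

/-- The real Laurent polynomial ring `ℝ[∂₁^{±1}, …, ∂ₙ^{±1}]`, as the group algebra of `ℤⁿ`;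
the monomial `∂^ν` is `AddMonoidAlgebra.single ν 1`. -/
abbrev Laurent (n : ℕ) : Type := AddMonoidAlgebra ℝ (Fin n → ℤ)

/-- `n`-dimensional trajectories with values in `ℝ^κ`. -/
abbrev Traj (n : ℕ) (κ : Type) : Type := (Fin n → ℤ) → κ → ℝ

variable {n d w k γ : ℕ} {ι κ : Type}

/-- The action of a Laurent polynomial in the shifts on a scalar trajectory:
`(∑ a_μ ∂^μ) v` at `ν` is `∑ a_μ v(ν + μ)`. -/
def act (f : Laurent n) (v : (Fin n → ℤ) → ℝ) : (Fin n → ℤ) → ℝ :=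
  fun ν => ∑ μ ∈ f.coeff.support, f.coeff μ * v (ν + μ)

/-- The action of a matrix of shift operators on a vector-valued trajectory. -/
def matAct [Fintype κ] (M : Matrix ι κ (Laurent n)) (v : Traj n κ) : Traj n ι :=
  fun ν i => ∑ j, act (M i j) (fun ν' => v ν' j) ν

/-- The behavior `ker R` of a matrix of shift operators. -/
def behavior [Fintype κ] (R : Matrix ι κ (Laurent n)) : Set (Traj n κ) :=
  {v | matAct R v = 0}

/-- The equation module: the row span of `R`. -/
def equationModule (R : Matrix (Fin k) (Fin w) (Laurent n)) :
    Submodule (Laurent n) (Fin w → Laurent n) :=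
  Submodule.span (Laurent n) (Set.range fun i => R i)

/-- The quotient module of the free row module by the equation module. -/
abbrev QuotientModule (R : Matrix (Fin k) (Fin w) (Laurent n)) : Type :=
  (Fin w → Laurent n) ⧸ equationModule R

/-- The characteristic ideal, generated by the `w × w` minors of `R`
(the zero ideal if `R` has fewer than `w` rows). -/
def characteristicIdeal (R : Matrix (Fin k) (Fin w) (Laurent n)) : Ideal (Laurent n) :=
  Ideal.span (Set.range fun e : Fin w ↪o Fin k => (R.submatrix e id).det)

/-- The system `ker R` is autonomous: its characteristic ideal is nonzero. -/
def IsAutonomous (R : Matrix (Fin k) (Fin w) (Laurent n)) : Prop :=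
  characteristicIdeal R ≠ ⊥

/-- The quotient of the ring of shift operators by the annihilator of the quotient module. -/
abbrev AnnihilatorQuotient (R : Matrix (Fin k) (Fin w) (Laurent n)) : Type :=
  Laurent n ⧸ Module.annihilator (Laurent n) (QuotientModule R)

/-- The pull-back of a coordinate change: `(pullback T w)(ν) = w(T ν)`. -/
def pullback (T : Matrix (Fin n) (Fin n) ℤ) (v : Traj n κ) : Traj n κ :=
  fun ν => v (T.mulVec ν)

/-- The index (from `0`) of the variable `∂_{d+1+j}`. -/
def highIndex (h : d ≤ n) (j : Fin (n - d)) : Fin n := ⟨d + j, by omega⟩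

/-- The first `d` coordinates of `ν ∈ ℤⁿ`. -/
def lowPart (h : d ≤ n) (ν : Fin n → ℤ) : Fin d → ℤ := fun i => ν (Fin.castLE h i)

/-- The last `n - d` coordinates of `ν ∈ ℤⁿ`. -/
def highPart (h : d ≤ n) (ν : Fin n → ℤ) : Fin (n - d) → ℤ := fun j => ν (highIndex h j)

/-- An `(n-d)`-dimensional trajectory of `d`-dimensional trajectories, seen as an `n`-dimensional
trajectory. -/
def toTraj (h : d ≤ n) (x : (Fin (n - d) → ℤ) → Traj d κ) : Traj n κ :=
  fun ν => x (highPart h ν) (lowPart h ν)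

/-- First-order form: `x` is a trajectory on `ℤ^{n-d}` in the state space `ker X`, it satisfies
`x(ν + e_j) = A_j x(ν)` for all `j` and `ν`, and `w = C x`. -/
def FirstOrder (h : d ≤ n) (X : Matrix (Fin k) (Fin γ) (Laurent d))
    (A : Fin (n - d) → Matrix (Fin γ) (Fin γ) (Laurent d))
    (C : Matrix (Fin w) (Fin γ) (Laurent d))
    (x : (Fin (n - d) → ℤ) → Traj d (Fin γ)) (v : Traj n (Fin w)) : Prop :=
  (∀ ν, x ν ∈ behavior X) ∧
  (∀ (j : Fin (n - d)) ν, x (ν + Pi.single j 1) = matAct (A j) (x ν)) ∧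
  v = toTraj h (fun ν => matAct C (x ν))

/-- Extension of `ν ∈ ℤᵈ` by zeros to `ℤⁿ`. -/
def extendZero (n d : ℕ) : (Fin d → ℤ) →+ (Fin n → ℤ) where
  toFun ν i := if h : (i : ℕ) < d then ν ⟨i, h⟩ else 0
  map_zero' := by ext i; simp
  map_add' a b := by ext i; by_cases h : (i : ℕ) < d <;> simp [h]

/-- The inclusion of the Laurent polynomial ring in `∂₁, …, ∂_d` into the one in
`∂₁, …, ∂ₙ`, for `d ≤ n`. -/
def incl (n d : ℕ) : Laurent d →+* Laurent n :=
  AddMonoidAlgebra.mapDomainRingHom ℝ (extendZero n d)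

/-- The shift `∂ᵢ`. -/
def shift (i : Fin n) : Laurent n := AddMonoidAlgebra.single (Pi.single i 1) 1

/-- The block matrix with block rows `[X, 0]`, `[∂_{d+j} I - A_j, 0]` for `1 ≤ j ≤ n - d`,
and `[-C, I]`. -/
def latentMatrix (h : d ≤ n) (X : Matrix (Fin k) (Fin γ) (Laurent d))
    (A : Fin (n - d) → Matrix (Fin γ) (Fin γ) (Laurent d))
    (C : Matrix (Fin w) (Fin γ) (Laurent d)) :
    Matrix (Fin k ⊕ (Fin (n - d) × Fin γ) ⊕ Fin w) (Fin γ ⊕ Fin w) (Laurent n) :=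
  Matrix.fromRows (Matrix.fromCols (X.map (incl n d)) 0) <|
  Matrix.fromRows
    (Matrix.fromCols
      (Matrix.of fun p c =>
        (Matrix.scalar (Fin γ) (shift (highIndex h p.1)) - (A p.1).map (incl n d)) p.2 c) 0)
    (Matrix.fromCols (-C.map (incl n d)) 1)

/-- The stacked trajectory `col(x, v)`. -/
def stack (x : Traj n (Fin γ)) (v : Traj n (Fin w)) : Traj n (Fin γ ⊕ Fin w) :=
  fun ν => Sum.elim (x ν) (v ν)

end NDSystem

end

open NDSystem

/-! By Malgrange's isomorphism (`mem_behavior_iff_exists_linearMap`) the behavior is the set of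
`Laurent n`-linear maps from M, the quotient of the free row module by the equation module, to the
scalar trajectories. The point is to make M a finite module over the shifts in only d variables.

Noether normalization (`exists_noether_normalization`) does this. After an automorphism of the
lattice ℤⁿ, the quotient of the ring by ann M is an integral extension of a Laurent ring in d'
variables. Integral extensions preserve dimension and `Laurent d'` has dimension d', so d' = d.
Since the rings are of finite type, M is finite over `Laurent d`.

Now choose generators of M over `Laurent d` (`exists_firstOrder_representation`). Their relations
give X, multiplication by the remaining shifts gives the matrices A_j, and the classes of the
standard basis vectors give C. A `Laurent d`-linear map on M is a tuple of trajectories killed by X,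
and it is `Laurent n`-linear exactly when it commutes with the remaining shifts, which is the
first-order system. The two representations differ only by currying ℤⁿ = ℤᵈ × ℤⁿ⁻ᵈ. -/

namespace NDSystem

/-! ### First-order representation of a finite module -/

/-- A module over `A` that is finite over the Noetherian subring `D` has a first-order
representation over `D`: its `A`-linear maps into `V` are the solutions of a first-order system,
provided that `A` is generated over `D` by the `z j` and their inverses. -/
theorem exists_firstOrder_representation {D A M V J I : Type*} [CommRing D] [IsNoetherianRing D]
    [CommRing A] [Algebra D A] [AddCommGroup M] [Module A M] [Module D M] [IsScalarTower D A M]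
    [Module.Finite D M] [AddCommGroup V] [Module A V] [Module D V] [IsScalarTower D A V]
    (z : J → A)
    (hz : ∀ S : Subalgebra D A, (∀ j, z j ∈ S) → (∀ j a, a * z j = 1 → a ∈ S) → S = ⊤)
    (e : I → M) :
    ∃ (γ k : ℕ) (X : Matrix (Fin k) (Fin γ) D) (F : J → Matrix (Fin γ) (Fin γ) D)
      (C : Matrix I (Fin γ) D), 0 < γ ∧ ∀ v : I → V,
        (∃ φ : M →ₗ[A] V, ∀ i, φ (e i) = v i) ↔
        ∃ x : Fin γ → V, (∀ r, ∑ c, X r c • x c = 0) ∧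
          (∀ j c, z j • x c = ∑ c', F j c c' • x c') ∧ ∀ i, v i = ∑ c, C i c • x c := by
  obtain ⟨γ, π, hπ, hγ⟩ : ∃ (γ : ℕ) (π : (Fin γ → D) →ₗ[D] M),
      Function.Surjective π ∧ 0 < γ := by
    obtain ⟨γ, π, hπ⟩ := Module.Finite.exists_fin' D M
    -- The extra generator is sent to zero; it makes γ positive even when M = 0.
    refine ⟨γ + 1, π ∘ₗ LinearMap.funLeft D D Fin.castSucc, ?_, γ.succ_pos⟩
    exact hπ.comp (LinearMap.funLeft_surjective_of_injective D D _ (Fin.castSucc_injective γ))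
  obtain ⟨k, X, hX⟩ := Submodule.fg_iff_exists_fin_generating_family.mp
    (IsNoetherian.noetherian (LinearMap.ker π))
  set g : Fin γ → M := fun c => π (Pi.single c 1) with hg
  have hπg : ∀ r, π r = ∑ c, r c • g c := fun r => by
    conv_lhs => rw [pi_eq_sum_univ' r]
    simp only [map_sum, map_smul, hg]
  choose F hF using fun j c => hπ (z j • g c)
  choose C hC using fun i => hπ (e i)
  refine ⟨γ, k, Matrix.of X, fun j => Matrix.of (F j), Matrix.of C, hγ, fun v => ⟨?_, ?_⟩⟩
  · rintro ⟨φ, hφ⟩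
    have key : ∀ r, φ (π r) = ∑ c, r c • φ (g c) := fun r => by
      rw [hπg, map_sum]
      refine Finset.sum_congr rfl fun c _ => ?_
      exact (φ.restrictScalars D).map_smul _ _
    refine ⟨fun c => φ (g c), fun r => ?_, fun j c => ?_, fun i => ?_⟩
    · have : X r ∈ LinearMap.ker π := hX ▸ Submodule.subset_span ⟨r, rfl⟩
      simp only [Matrix.of_apply, ← key, LinearMap.mem_ker.mp this, map_zero]
    · simp only [Matrix.of_apply, ← key, hF, map_smul]
    · simp only [Matrix.of_apply, ← key, hC, hφ]
  · rintro ⟨x, hx, hxF, hxC⟩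
    let y : (Fin γ → D) →ₗ[D] V := Fintype.linearCombination D x
    have hy : ∀ r, y r = ∑ c, r c • x c := fun r => Fintype.linearCombination_apply D x r
    -- The rows of X generate all relations among the generators, so a tuple killed by X extends to
    -- a D-linear map ψ on M.
    have hker : LinearMap.ker π ≤ LinearMap.ker y := by
      rw [← hX, Submodule.span_le]
      rintro _ ⟨r, rfl⟩
      exact (hy _).trans (hx r)
    let ψ : M →ₗ[D] V :=
      (LinearMap.ker π).liftQ y hker ∘ₗ (π.quotKerEquivOfSurjective hπ).symm.toLinearMap
    have hψ : ∀ r, ψ (π r) = ∑ c, r c • x c := fun r => by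
      rw [← hy]
      simp only [ψ, LinearMap.comp_apply, LinearEquiv.coe_coe]
      rw [show (π.quotKerEquivOfSurjective hπ).symm (π r) = Submodule.Quotient.mk r from
        (LinearEquiv.symm_apply_eq _).mpr rfl]
      rfl
    have hψg : ∀ c, ψ (g c) = x c := fun c => by
      rw [hg, hψ]; simp [Pi.single_apply]
    -- The scalars that commute with ψ form a subalgebra. The first-order equations put each z j
    -- into it, so `hz` makes it all of A.
    let S : Subalgebra D A :=
      { carrier := {a | ∀ m, ψ (a • m) = a • ψ m}
        mul_mem' := fun {a b} ha hb m => by rw [mul_smul, ha, hb, mul_smul]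
        add_mem' := fun {a b} ha hb m => by rw [add_smul, map_add, ha, hb, add_smul]
        algebraMap_mem' := fun r m => by rw [algebraMap_smul, map_smul, algebraMap_smul] }
    have hzS : ∀ j, z j ∈ S := fun j m => by
      obtain ⟨r, rfl⟩ := hπ m
      rw [hπg]
      simp only [Finset.smul_sum, map_sum, smul_comm (z j), map_smul, hψg, hxF]
      refine Finset.sum_congr rfl fun c _ => ?_
      rw [← hF, hψ, Finset.smul_sum]
      rfl
    -- Inverses stay in S: if a z = 1, then ψ(am) = a z ψ(am) = a ψ(z a m) = a ψ(m).
    have hS : S = ⊤ := hz S hzS fun j a ha m => by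
      rw [← one_smul A (ψ (a • m)), ← ha, mul_smul, ← hzS j, ← mul_smul, mul_comm, ha, one_smul]
    refine ⟨{ ψ with map_smul' := fun a m => (hS ▸ Algebra.mem_top : a ∈ S) m }, fun i => ?_⟩
    change ψ (e i) = v i
    rw [← hC, hψ, hxC]
    rfl

/-! ### Noether normalization for Laurent polynomial rings -/

/-- A unit satisfying a Laurent relation with distinct exponents and unit coefficients is
integral. -/
theorem isIntegral_unit_of_sum_eq_zero {D S ι : Type*} [CommRing D] [CommRing S] [Algebra D S]
    (x : Sˣ) (s : Finset ι) (hs : s.Nonempty) (c : ι → D) (hc : ∀ i ∈ s, IsUnit (c i))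
    (l : ι → ℤ) (hl : Set.InjOn l s)
    (h : ∑ i ∈ s, algebraMap D S (c i) * ((x ^ l i : Sˣ) : S) = 0) : IsIntegral D (x : S) := by
  classical
  obtain ⟨i₀, hi₀, hmax⟩ := s.exists_max_image l hs
  obtain ⟨i₁, hi₁, hmin⟩ := s.exists_min_image l hs
  obtain ⟨u, hu⟩ := hc i₀ hi₀
  -- Dividing the relation by the lowest power of x makes all exponents natural, and dividing by the
  -- unit u makes the top coefficient 1. The other terms form q, of smaller degree because the
  -- exponents are distinct.
  let q : Polynomial D := ∑ i ∈ s.erase i₀,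
    Polynomial.monomial (l i - l i₁).toNat (((u⁻¹ : Dˣ) : D) * c i)
  have hq : q.degree < ((l i₀ - l i₁).toNat : WithBot ℕ) := by
    refine (Polynomial.degree_sum_le _ _).trans_lt ?_
    rw [Finset.sup_lt_iff (WithBot.bot_lt_coe _)]
    intro i hi
    refine (Polynomial.degree_monomial_le _ _).trans_lt ?_
    have hi' := Finset.mem_of_mem_erase hi
    have h1 : l i ≠ l i₀ := fun h => Finset.ne_of_mem_erase hi (hl hi' hi₀ h)
    have := hmax i hi'
    have := hmin i hi'
    exact_mod_cast (by omega : (l i - l i₁).toNat < (l i₀ - l i₁).toNat)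
  refine ⟨_, Polynomial.monic_X_pow_add hq, ?_⟩
  have hpow : ∀ i ∈ s, (x : S) ^ (l i - l i₁).toNat =
      ((x ^ l i : Sˣ) : S) * ((x ^ (-l i₁) : Sˣ) : S) := fun i hi => by
    rw [← Units.val_mul, ← zpow_add, ← Units.val_pow_eq_pow_val, ← zpow_natCast,
      Int.toNat_of_nonneg (sub_nonneg.mpr (hmin i hi)), sub_eq_add_neg]
  have h2 : ∑ i ∈ s, algebraMap D S (((u⁻¹ : Dˣ) : D) * c i) * (x : S) ^ (l i - l i₁).toNat
      = 0 := by
    calc _ = algebraMap D S ((u⁻¹ : Dˣ) : D) *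
          (∑ i ∈ s, algebraMap D S (c i) * ((x ^ l i : Sˣ) : S)) *
          ((x ^ (-l i₁) : Sˣ) : S) := by
          rw [Finset.mul_sum, Finset.sum_mul]
          refine Finset.sum_congr rfl fun i hi => ?_
          rw [hpow i hi, map_mul]; ring
      _ = 0 := by rw [h]; simp
  rw [← Finset.add_sum_erase _ _ hi₀, ← hu, Units.inv_mul, map_one, one_mul] at h2
  simpa [q, Polynomial.eval₂_finsetSum, Polynomial.eval₂_monomial] using h2

/-- Some integral linear form with coefficient `1` at the last variable separates the points of a
finite set. -/
theorem exists_injOn_linearForm {n : ℕ} (s : Finset (Fin (n + 1) → ℤ)) :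
    ∃ c : (Fin (n + 1) → ℤ) →+ ℤ, c (Pi.single (Fin.last n) 1) = 0 ∧
      Set.InjOn (fun μ => μ (Fin.last n) + c μ) s := by
  classical
  -- The coordinates of μ become polynomial coefficients, the last one being the constant term. An
  -- integer t that is no root of any p(μ - ν) gives the separating form μ ↦ p(μ)(t).
  let p : (Fin (n + 1) → ℤ) → Polynomial ℤ := fun μ =>
    ∑ i : Fin (n + 1), Polynomial.monomial (n - (i : ℕ)) (μ i)
  have hp : ∀ μ, p μ = 0 → μ = 0 := fun μ h => by
    ext i
    have := congrArg (Polynomial.coeff · (n - i)) h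
    simp only [p, Polynomial.finsetSum_coeff, Polynomial.coeff_monomial,
      Polynomial.coeff_zero] at this
    rw [Finset.sum_eq_single i] at this
    · simpa using this
    · intro j _ hj
      rw [if_neg]
      intro h'
      apply hj
      ext
      omega
    · simp
  have hprod : ∏ q ∈ s.offDiag, p (q.1 - q.2) ≠ 0 := Finset.prod_ne_zero_iff.mpr fun q hq h =>
    (Finset.mem_offDiag.mp hq).2.2 (sub_eq_zero.mp (hp _ h))
  obtain ⟨t, ht⟩ : ∃ t : ℤ, (∏ q ∈ s.offDiag, p (q.1 - q.2)).eval t ≠ 0 := by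
    by_contra! h
    exact hprod (Polynomial.funext fun t => by simp [h t])
  refine ⟨∑ i : Fin n, ((AddMonoidHom.mulRight (t ^ (n - (i : ℕ)))).comp
    (Pi.evalAddMonoidHom _ i.castSucc)), ?_, ?_⟩
  · simp [AddMonoidHom.finsetSum_apply, (Fin.castSucc_lt_last _).ne]
  · intro μ hμ ν hν h
    by_contra hne
    rw [Polynomial.eval_prod, Finset.prod_ne_zero_iff] at ht
    refine ht (μ, ν) (Finset.mem_offDiag.mpr ⟨hμ, hν, hne⟩) ?_
    simp only [AddMonoidHom.finsetSum_apply, AddMonoidHom.comp_apply,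
      AddMonoidHom.coe_mulRight, Pi.evalAddMonoidHom_apply] at h
    simp only [p, Polynomial.eval_finsetSum, Polynomial.eval_monomial]
    simp only [Fin.sum_univ_castSucc, Fin.val_last, Fin.val_castSucc, Pi.sub_apply, sub_mul,
      Finset.sum_sub_distrib, Nat.sub_self, pow_zero, mul_one]
    linarith

theorem isUnit_single {n : ℕ} (a : Fin n → ℤ) {r : ℝ} (hr : r ≠ 0) :
    IsUnit (AddMonoidAlgebra.single a r : Laurent n) :=
  IsUnit.of_mul_eq_one (AddMonoidAlgebra.single (-a) r⁻¹) (by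
    rw [AddMonoidAlgebra.single_mul_single, add_neg_cancel, mul_inv_cancel₀ hr]; rfl)

/-- The monomial `∂^μ` as a unit. -/
noncomputable def monomialUnit {n : ℕ} : Multiplicative (Fin n → ℤ) →* (Laurent n)ˣ :=
  (AddMonoidAlgebra.of ℝ (Fin n → ℤ)).toHomUnits

/-- The elementary coordinate change `μ ↦ μ - c(μ) e`, where `c(e) = 0`. -/
def shear {G : Type*} [AddCommGroup G] (c : G →+ ℤ) (e : G) (hc : c e = 0) : G ≃+ G where
  toFun μ := μ - c μ • e
  invFun μ := μ + c μ • e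
  left_inv μ := by simp [hc]
  right_inv μ := by simp [hc]
  map_add' a b := by simp only [map_add, add_smul]; abel

/-- The integral closure of D in S contains the image of A, over which S is integral; transitivity
concludes. -/
theorem isIntegral_of_forall_range {A D S : Type*} [CommRing A] [CommRing D] [CommRing S]
    (φ : A →+* S) (hφ : φ.IsIntegral) (ψ : D →+* S) (h : ∀ a, ψ.IsIntegralElem (φ a)) :
    ψ.IsIntegral := by
  let := ψ.toAlgebra
  let := φ.toAlgebra
  let φ' : A →+* integralClosure D S := φ.codRestrict (integralClosure D S) h
  let := φ'.toAlgebra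
  have : IsScalarTower A (integralClosure D S) S := IsScalarTower.of_algebraMap_eq fun _ => rfl
  intro s
  exact isIntegral_trans (A := integralClosure D S) s (IsIntegral.tower_top (hφ s))

/-- One elimination step of Noether normalization. -/
theorem exists_isIntegral_of_not_injective {n : ℕ} {S : Type*} [CommRing S]
    (φ : Laurent (n + 1) →+* S) (hφ : φ.IsIntegral) (hinj : ¬ Function.Injective φ) :
    ∃ U : (Fin (n + 1) → ℤ) ≃+ (Fin (n + 1) → ℤ),
      (φ.comp (AddMonoidAlgebra.mapDomainRingHom ℝ
        (U.toAddMonoidHom.comp (extendZero (n + 1) n)))).IsIntegral := by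
  obtain ⟨f, hf, hf0⟩ : ∃ f, φ f = 0 ∧ f ≠ 0 := by
    rw [injective_iff_map_eq_zero] at hinj
    push Not at hinj
    exact hinj
  obtain ⟨c, hc, hl⟩ := exists_injOn_linearForm f.coeff.support
  set e : Fin (n + 1) → ℤ := Pi.single (Fin.last n) 1 with he
  refine ⟨shear c e hc, ?_⟩
  set ψ := φ.comp (AddMonoidAlgebra.mapDomainRingHom ℝ
    ((shear c e hc).toAddMonoidHom.comp (extendZero (n + 1) n))) with hψ
  let x : Sˣ := Units.map φ.toMonoidHom (monomialUnit (Multiplicative.ofAdd e))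
  have hx : ∀ j : ℤ, ((x ^ j : Sˣ) : S) = φ (AddMonoidAlgebra.single (j • e) 1) := fun j => by
    rw [← map_zpow, ← map_zpow, ← ofAdd_zsmul]
    rfl
  -- In the sheared coordinates the last exponent of ∂^μ is the separating form, so distinct
  -- monomials of f carry distinct powers of x.
  have hsingle : ∀ (μ : Fin (n + 1) → ℤ) (r : ℝ), φ (AddMonoidAlgebra.single μ r) =
      ψ (AddMonoidAlgebra.single (fun i => μ i.castSucc) r) *
        ((x ^ (μ (Fin.last n) + c μ) : Sˣ) : S) := fun μ r => by
    rw [hx, hψ, RingHom.comp_apply, ← map_mul]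
    congr 1
    simp only [AddMonoidAlgebra.mapDomainRingHom_apply, AddMonoidAlgebra.mapDomain_single,
      AddMonoidAlgebra.single_mul_single, mul_one]
    congr 1
    have hμ : extendZero (n + 1) n (fun i => μ i.castSucc) = μ - μ (Fin.last n) • e := by
      ext i
      refine Fin.lastCases ?_ (fun i => ?_) i
      · simp [extendZero, he]
      · simp [extendZero, he, (Fin.castSucc_lt_last _).ne]
    simp only [AddMonoidHom.comp_apply, hμ]
    change μ = (μ - μ (Fin.last n) • e) - c (μ - μ (Fin.last n) • e) • e + _
    rw [map_sub, map_zsmul, hc, smul_zero, sub_zero, add_smul]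
    abel
  let := ψ.toAlgebra
  have hsum : ∑ μ ∈ f.coeff.support,
      algebraMap (Laurent n) S (AddMonoidAlgebra.single (fun i => μ i.castSucc) (f.coeff μ)) *
        ((x ^ (μ (Fin.last n) + c μ) : Sˣ) : S) = 0 := by
    rw [← hf]
    conv_rhs => rw [← AddMonoidAlgebra.sum_coeff_single f, Finsupp.sum, map_sum]
    exact Finset.sum_congr rfl fun μ _ => (hsingle _ _).symm
  have hne : f.coeff.support.Nonempty := by
    rwa [Finsupp.support_nonempty_iff, Ne, AddMonoidAlgebra.coeff_eq_zero]
  -- Each power of x has a single monomial as its coefficient, hence a unit. So both the top and the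
  -- bottom coefficient are units, and x and x⁻¹ are both integral.
  have hunit : ∀ μ ∈ f.coeff.support, IsUnit
      (AddMonoidAlgebra.single (fun i : Fin n => μ i.castSucc) (f.coeff μ) : Laurent n) :=
    fun μ hμ => isUnit_single _ (Finsupp.mem_support_iff.mp hμ)
  have h1 : IsIntegral (Laurent n) (x : S) :=
    isIntegral_unit_of_sum_eq_zero x _ hne _ hunit _ hl hsum
  have h2 : IsIntegral (Laurent n) ((x⁻¹ : Sˣ) : S) :=
    isIntegral_unit_of_sum_eq_zero x⁻¹ _ hne _ hunit (fun μ => -(μ (Fin.last n) + c μ))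
      (fun a ha b hb h => hl ha hb (neg_injective h))
      (by simpa only [inv_zpow', neg_neg] using hsum)
  have h3 : ∀ j : ℤ, IsIntegral (Laurent n) ((x ^ j : Sˣ) : S) := fun j => by
    obtain ⟨k, rfl | rfl⟩ := j.eq_nat_or_neg
    · simpa using h1.pow k
    · simpa only [zpow_neg, zpow_natCast, ← inv_pow, Units.val_pow_eq_pow_val] using h2.pow k
  refine isIntegral_of_forall_range φ hφ ψ fun a => ?_
  change IsIntegral (Laurent n) (φ a)
  induction a using AddMonoidAlgebra.induction_linear with
  | zero => simpa using isIntegral_zero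
  | add a b ha hb => simpa using ha.add hb
  | single μ r => rw [hsingle]; exact isIntegral_algebraMap.mul (h3 _)

/-- Extension of a coordinate change by the identity on the last coordinate. -/
def extendEquiv {n : ℕ} (U : (Fin n → ℤ) ≃+ (Fin n → ℤ)) :
    (Fin (n + 1) → ℤ) ≃+ (Fin (n + 1) → ℤ) where
  toFun μ := Fin.snoc (α := fun _ => ℤ) (U (fun i => μ i.castSucc)) (μ (Fin.last n))
  invFun μ := Fin.snoc (α := fun _ => ℤ) (U.symm (fun i => μ i.castSucc)) (μ (Fin.last n))
  left_inv μ := by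
    ext i
    refine Fin.lastCases ?_ (fun i => ?_) i <;> simp
  right_inv μ := by
    ext i
    refine Fin.lastCases ?_ (fun i => ?_) i <;> simp
  map_add' a b := by
    ext i
    refine Fin.lastCases ?_ (fun i => ?_) i
    · simp
    · simp only [Fin.snoc_castSucc, Pi.add_apply]
      exact congrFun (map_add U (fun i => a i.castSucc) fun i => b i.castSucc) i

theorem extendEquiv_comp_extendZero {n d : ℕ} (hd : d ≤ n) (U : (Fin n → ℤ) ≃+ (Fin n → ℤ))
    (a : Fin d → ℤ) : extendEquiv U (extendZero (n + 1) d a) =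
      extendZero (n + 1) n (U (extendZero n d a)) := by
  ext i
  refine Fin.lastCases ?_ (fun i => ?_) i
  · have : ¬ n < d := by omega
    simp [extendEquiv, extendZero, this]
  · simp [extendEquiv, extendZero]

theorem extendZero_self {n : ℕ} : extendZero n n = AddMonoidHom.id _ := by
  ext; simp [extendZero]

theorem comp_mapDomainRingHom_refl {S : Type*} [CommRing S] {n : ℕ} (φ : Laurent n →+* S) :
    φ.comp (AddMonoidAlgebra.mapDomainRingHom ℝ
      ((AddEquiv.refl (Fin n → ℤ)).toAddMonoidHom.comp (extendZero n n))) = φ := by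
  have : (AddEquiv.refl (Fin n → ℤ)).toAddMonoidHom.comp (extendZero n n) =
    AddMonoidHom.id _ := by rw [extendZero_self]; rfl
  rw [this, AddMonoidAlgebra.mapDomainRingHom_id, RingHom.comp_id]

/-- Noether normalization for Laurent polynomial rings by unimodular coordinate changes. -/
theorem exists_noether_normalization {S : Type*} [CommRing S] [Nontrivial S] {n : ℕ}
    (φ : Laurent n →+* S) (hφ : φ.IsIntegral) :
    ∃ d ≤ n, ∃ U : (Fin n → ℤ) ≃+ (Fin n → ℤ),
      (φ.comp (AddMonoidAlgebra.mapDomainRingHom ℝ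
        (U.toAddMonoidHom.comp (extendZero n d)))).IsIntegral ∧
      Function.Injective (φ.comp (AddMonoidAlgebra.mapDomainRingHom ℝ
        (U.toAddMonoidHom.comp (extendZero n d)))) := by
  induction n with
  | zero =>
    refine ⟨0, le_rfl, AddEquiv.refl _, ?_⟩
    rw [comp_mapDomainRingHom_refl]
    refine ⟨hφ, (injective_iff_map_eq_zero φ).mpr fun f hf => ?_⟩
    by_contra h0
    -- `Laurent 0` is the field ℝ, so a nonzero f in the kernel would be a unit mapping to zero.
    have hfs : f = AddMonoidAlgebra.single 0 (f.coeff 0) := by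
      refine AddMonoidAlgebra.ext (Finsupp.ext fun a => ?_)
      rw [Subsingleton.elim a 0, AddMonoidAlgebra.coeff_single, Finsupp.single_eq_same]
    have : IsUnit f := by
      rw [hfs]
      refine isUnit_single _ fun h => h0 ?_
      rw [hfs, h, AddMonoidAlgebra.single_zero]
    exact not_isUnit_zero (hf ▸ this.map φ)
  | succ n ih =>
    by_cases hinj : Function.Injective φ
    · refine ⟨n + 1, le_rfl, AddEquiv.refl _, ?_⟩
      rw [comp_mapDomainRingHom_refl]
      exact ⟨hφ, hinj⟩
    obtain ⟨U₁, hU₁⟩ := exists_isIntegral_of_not_injective φ hφ hinj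
    obtain ⟨d, hd, U₂, h⟩ := ih _ hU₁
    refine ⟨d, hd.trans n.le_succ, (extendEquiv U₂).trans U₁, ?_⟩
    have hcomp : ((extendEquiv U₂).trans U₁).toAddMonoidHom.comp (extendZero (n + 1) d) =
        (U₁.toAddMonoidHom.comp (extendZero (n + 1) n)).comp
          (U₂.toAddMonoidHom.comp (extendZero n d)) :=
      DFunLike.ext _ _ fun a => congrArg U₁ (extendEquiv_comp_extendZero hd U₂ a)
    rwa [hcomp, AddMonoidAlgebra.mapDomainRingHom_comp, ← RingHom.comp_assoc]

/-! ### Krull dimension -/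

/-- By incomparability, contraction of primes is strictly monotone; this needs no injectivity. -/
theorem ringKrullDim_le_of_isIntegral {A S : Type*} [CommRing A] [CommRing S] (f : A →+* S)
    (hf : f.IsIntegral) : ringKrullDim S ≤ ringKrullDim A := by
  let := f.toAlgebra
  have : Algebra.IsIntegral A S := ⟨hf⟩
  exact Order.krullDim_le_of_strictMono (PrimeSpectrum.comap (algebraMap A S))
    fun _ _ h => Ideal.IsIntegral.comap_lt_comap h

/-- Lying over, which uses injectivity, lifts the head of a chain of primes, and going up lifts the
rest. -/
theorem ringKrullDim_eq_of_isIntegral {A S : Type*} [CommRing A] [CommRing S] (f : A →+* S)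
    (hf : f.IsIntegral) (hinj : Function.Injective f) : ringKrullDim S = ringKrullDim A := by
  refine le_antisymm (ringKrullDim_le_of_isIntegral f hf) ?_
  obtain hsurj := hf.comap_surjective hinj
  let := f.toAlgebra
  have : Algebra.IsIntegral A S := ⟨hf⟩
  refine iSup_le fun l => ?_
  obtain ⟨Q, hQ⟩ := hsurj l.head
  have : Q.asIdeal.LiesOver l.head.asIdeal := ⟨by rw [← hQ]; rfl⟩
  obtain ⟨L, hL, -⟩ := Ideal.exists_ltSeries_of_hasGoingUp l Q.asIdeal
  rw [← hL]
  exact le_iSup (fun L : LTSeries (PrimeSpectrum S) => (L.length : WithBot ℕ∞)) L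

/-- Both ∂ᵢ and its inverse are roots of Y² - XᵢY + 1 when Xᵢ maps to their sum. This bounds the
dimension of `Laurent n` by that of a polynomial ring. -/
theorem isIntegral_aeval_add_inv (n : ℕ) :
    (MvPolynomial.aeval (R := ℝ) (fun i : Fin n =>
      (AddMonoidAlgebra.single (Pi.single i 1) 1 + AddMonoidAlgebra.single (Pi.single i (-1)) 1 :
        Laurent n))).toRingHom.IsIntegral := by
  set ψ := (MvPolynomial.aeval (R := ℝ) (fun i : Fin n =>
      (AddMonoidAlgebra.single (Pi.single i 1) 1 + AddMonoidAlgebra.single (Pi.single i (-1)) 1 :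
        Laurent n))).toRingHom with hψ
  let := ψ.toAlgebra
  have hX : ∀ i, algebraMap (MvPolynomial (Fin n) ℝ) (Laurent n) (MvPolynomial.X i) =
      AddMonoidAlgebra.single (Pi.single i 1) 1 + AddMonoidAlgebra.single (Pi.single i (-1)) 1 :=
    fun i => MvPolynomial.aeval_X _ i
  have hmul : ∀ i : Fin n, (AddMonoidAlgebra.single (Pi.single i 1) 1 : Laurent n) *
      AddMonoidAlgebra.single (Pi.single i (-1)) 1 = 1 := fun i => by
    rw [AddMonoidAlgebra.single_mul_single, ← Pi.single_add]; simp; rfl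
  have hroot : ∀ (i : Fin n) (y : Laurent n),
      y * y - algebraMap (MvPolynomial (Fin n) ℝ) (Laurent n) (MvPolynomial.X i) * y + 1 = 0 →
      IsIntegral (MvPolynomial (Fin n) ℝ) y := fun i y hy => by
    refine ⟨Polynomial.X ^ 2 + (Polynomial.C (-MvPolynomial.X i) * Polynomial.X + Polynomial.C 1),
      Polynomial.monic_X_pow_add Polynomial.degree_linear_lt, ?_⟩
    simp only [Polynomial.eval₂_add, Polynomial.eval₂_mul, Polynomial.eval₂_pow,
      Polynomial.eval₂_X, Polynomial.eval₂_C]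
    rw [← hy, map_neg, map_one]; ring
  have hz : ∀ (i : Fin n) (k : ℤ), IsIntegral (MvPolynomial (Fin n) ℝ)
      (AddMonoidAlgebra.single (Pi.single i k) 1 : Laurent n) := fun i k => by
    obtain ⟨k, rfl | rfl⟩ := k.eq_nat_or_neg
    · have := (hroot i (AddMonoidAlgebra.single (Pi.single i 1) 1) (by
        rw [hX, add_mul, mul_comm _ (AddMonoidAlgebra.single (Pi.single i 1) 1),
          mul_comm (AddMonoidAlgebra.single (Pi.single i (-1)) 1), hmul]; ring)).pow k
      simpa [AddMonoidAlgebra.single_pow, ← Pi.single_smul] using this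
    · have := (hroot i (AddMonoidAlgebra.single (Pi.single i (-1)) 1) (by
        rw [hX, add_mul, hmul]; ring)).pow k
      simpa [AddMonoidAlgebra.single_pow, ← Pi.single_smul] using this
  intro f
  change IsIntegral _ f
  induction f using AddMonoidAlgebra.induction_linear with
  | zero => exact isIntegral_zero
  | add a b ha hb => exact ha.add hb
  | single μ r =>
    have h1 : (AddMonoidAlgebra.single μ r : Laurent n) =
        algebraMap (MvPolynomial (Fin n) ℝ) (Laurent n) (MvPolynomial.C r) *
          ∏ i, AddMonoidAlgebra.single (Pi.single i (μ i)) 1 := by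
      have : algebraMap (MvPolynomial (Fin n) ℝ) (Laurent n) (MvPolynomial.C r) =
          AddMonoidAlgebra.single 0 r := MvPolynomial.aeval_C _ r
      rw [this, AddMonoidAlgebra.prod_single, Finset.univ_sum_single,
        AddMonoidAlgebra.single_mul_single]
      simp
    rw [h1]
    exact isIntegral_algebraMap.mul (IsIntegral.prod _ fun i _ => hz i _)

/-- The Laurent polynomial ring in `n` variables over a field has dimension `n`. -/
theorem ringKrullDim_laurent (n : ℕ) : ringKrullDim (Laurent n) = n := by
  refine le_antisymm ?_ ?_
  · refine (ringKrullDim_le_of_isIntegral _ (isIntegral_aeval_add_inv n)).trans ?_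
    rw [MvPolynomial.ringKrullDim_of_isNoetherianRing, ringKrullDim_eq_zero_of_field]
    simp
  · induction n with
    | zero => simpa using ringKrullDim_nonneg_of_nontrivial
    | succ n ih =>
      let π : (Fin (n + 1) → ℤ) →+ (Fin n → ℤ) :=
        { toFun := fun μ i => μ i.castSucc, map_zero' := rfl, map_add' := fun _ _ => rfl }
      have hsurj : Function.Surjective (AddMonoidAlgebra.mapDomainRingHom ℝ π) := fun f => by
        refine ⟨AddMonoidAlgebra.mapDomainRingHom ℝ (extendZero (n + 1) n) f, ?_⟩
        rw [← RingHom.comp_apply, ← AddMonoidAlgebra.mapDomainRingHom_comp]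
        have : π.comp (extendZero (n + 1) n) = AddMonoidHom.id _ :=
          AddMonoidHom.ext fun a => by ext i; simp [π, extendZero]
        rw [this, AddMonoidAlgebra.mapDomainRingHom_id]
        rfl
      -- Setting the last shift to 1 kills this nonzerodivisor and leaves `Laurent n`, so the
      -- dimension drops by at least one.
      let r : Laurent (n + 1) := AddMonoidAlgebra.single (Pi.single (Fin.last n) 1) 1 - 1
      have hr : r ∈ nonZeroDivisors (Laurent (n + 1)) := by
        refine mem_nonZeroDivisors_of_ne_zero (sub_ne_zero.mpr fun h => ?_)
        rw [AddMonoidAlgebra.one_def, AddMonoidAlgebra.single_left_inj one_ne_zero] at h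
        simpa using congrFun h (Fin.last n)
      have hr0 : AddMonoidAlgebra.mapDomainRingHom ℝ π r = 0 := by
        have : π (Pi.single (Fin.last n) 1) = 0 := by
          ext i; simp [π, (Fin.castSucc_lt_last _).ne]
        rw [map_sub, map_one, AddMonoidAlgebra.mapDomainRingHom_apply,
          AddMonoidAlgebra.mapDomain_single, this, AddMonoidAlgebra.one_def, sub_self]
      refine le_trans ?_ (ringKrullDim_succ_le_of_surjective _ hsurj hr hr0)
      push_cast
      gcongr

/-! ### From integrality to finiteness of the module -/

/-- Integral and of finite type means finite, so A/ann M is finite over D; M is finite over A/ann M.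
-/
theorem finite_of_isIntegral_quotient_annihilator {D A M : Type*} [CommRing D] [CommRing A]
    [Algebra D A] [Algebra.FiniteType D A] [AddCommGroup M] [Module A M] [Module D M]
    [IsScalarTower D A M] [Module.Finite A M]
    (h : ((Ideal.Quotient.mk (Module.annihilator A M)).comp (algebraMap D A)).IsIntegral) :
    Module.Finite D M := by
  have : Algebra.IsIntegral D (A ⧸ Module.annihilator A M) := ⟨h⟩
  have : Module.Finite D (A ⧸ Module.annihilator A M) := Algebra.IsIntegral.finite
  let : Module (A ⧸ Module.annihilator A M) M :=
    (Module.isTorsionBySet_annihilator A M).module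
  have : IsScalarTower A (A ⧸ Module.annihilator A M) M :=
    (Module.isTorsionBySet_annihilator A M).isScalarTower
  have : Module.Finite (A ⧸ Module.annihilator A M) M :=
    Module.Finite.of_restrictScalars_finite A _ M
  have : IsScalarTower D (A ⧸ Module.annihilator A M) M := ⟨fun r q m => by
    obtain ⟨a, rfl⟩ := Ideal.Quotient.mk_surjective q
    change Ideal.Quotient.mk _ (r • a) • m = r • (a • m)
    rw [← smul_assoc]
    rfl⟩
  exact Module.Finite.trans (A ⧸ Module.annihilator A M) M

/-! ### Trajectories as a module, and Malgrange's isomorphism -/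

/-- Scalar trajectories on `ℤⁿ`, as a module over the ring of shift operators. -/
def ScalarTraj (n : ℕ) : Type := (Fin n → ℤ) → ℝ

namespace ScalarTraj

variable {n : ℕ}

noncomputable instance : AddCommGroup (ScalarTraj n) :=
  inferInstanceAs (AddCommGroup ((Fin n → ℤ) → ℝ))

noncomputable instance : Module ℝ (ScalarTraj n) :=
  inferInstanceAs (Module ℝ ((Fin n → ℤ) → ℝ))

/-- The representation of `ℤⁿ` on scalar trajectories by shifts. -/
noncomputable def translation (n : ℕ) :
    Multiplicative (Fin n → ℤ) →* Module.End ℝ (ScalarTraj n) where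
  toFun μ :=
    { toFun := fun v ν => v (ν + μ.toAdd)
      map_add' := fun _ _ => rfl
      map_smul' := fun _ _ => rfl }
  map_one' := LinearMap.ext fun v => funext fun ν => congrArg v (add_zero ν)
  map_mul' a b := LinearMap.ext fun v => funext fun ν =>
    congrArg v (add_assoc ν a.toAdd b.toAdd).symm

noncomputable instance : Module (Laurent n) (ScalarTraj n) :=
  Module.compHom _ (AddMonoidAlgebra.lift ℝ (Module.End ℝ (ScalarTraj n)) (Fin n → ℤ)
    (translation n)).toRingHom

end ScalarTraj

variable {n d w k γ : ℕ}

theorem smul_eq_act (f : Laurent n) (v : ScalarTraj n) : f • v = act f v := by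
  change (AddMonoidAlgebra.lift ℝ (Module.End ℝ (ScalarTraj n)) (Fin n → ℤ)
    (ScalarTraj.translation n) f) v = _
  rw [AddMonoidAlgebra.lift_apply, Finsupp.sum, LinearMap.sum_apply]
  funext ν
  exact Finset.sum_apply (M := fun _ => ℝ) ν _ _

theorem mapDomainRingHom_smul_apply (g : (Fin d → ℤ) →+ (Fin n → ℤ)) (f : Laurent d)
    (v : ScalarTraj n) (ν : Fin n → ℤ) :
    (AddMonoidAlgebra.mapDomainRingHom ℝ g f • v) ν =
      ∑ μ ∈ f.coeff.support, f.coeff μ * v (ν + g μ) := by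
  rw [smul_eq_act]
  change (Finsupp.mapDomain g f.coeff).sum (fun μ r => r * v (ν + μ)) = _
  rw [Finsupp.sum_mapDomain_index (by simp) (by simp [add_mul])]
  rfl

theorem single_one_smul_apply (μ : Fin n → ℤ) (v : ScalarTraj n) (ν : Fin n → ℤ) :
    ((AddMonoidAlgebra.single μ 1 : Laurent n) • v) ν = v (ν + μ) := by
  rw [smul_eq_act]
  change (Finsupp.single μ (1 : ℝ)).sum (fun μ r => r * v (ν + μ)) = _
  simp

/-- The `j`-th component of a trajectory. -/
def component {κ : Type} (v : Traj n κ) (j : κ) : ScalarTraj n := fun ν => v ν j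

theorem matAct_apply {ι κ : Type} [Fintype κ] (M : Matrix ι κ (Laurent n)) (v : Traj n κ)
    (ν : Fin n → ℤ) (i : ι) : matAct M v ν i = (∑ j, M i j • component v j) ν := by
  simp only [smul_eq_act]
  exact (Finset.sum_apply (M := fun _ => ℝ) ν _ _).symm

theorem matAct_eq_zero_iff {ι κ : Type} [Fintype κ] (M : Matrix ι κ (Laurent n))
    (v : Traj n κ) : matAct M v = 0 ↔ ∀ i, ∑ j, M i j • component v j = 0 := by
  constructor
  · intro h i
    funext ν
    rw [← matAct_apply, h]
    rfl
  · intro h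
    funext ν i
    rw [matAct_apply, h]
    rfl

/-- Malgrange's isomorphism: the behavior is the set of `Laurent n`-linear maps from the quotient
module to the scalar trajectories. -/
theorem mem_behavior_iff_exists_linearMap (R : Matrix (Fin k) (Fin w) (Laurent n))
    (v : Traj n (Fin w)) : v ∈ behavior R ↔
      ∃ φ : QuotientModule R →ₗ[Laurent n] ScalarTraj n,
        ∀ i, φ (Submodule.Quotient.mk (Pi.single i 1)) = component v i := by
  rw [behavior, Set.mem_ofPred_eq, matAct_eq_zero_iff]
  constructor
  · intro h
    have hle : equationModule R ≤
        LinearMap.ker (Fintype.linearCombination (Laurent n) (component v)) := by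
      rw [equationModule, Submodule.span_le]
      rintro _ ⟨r, rfl⟩
      exact (Fintype.linearCombination_apply _ _ _).trans (h r)
    refine ⟨(equationModule R).liftQ _ hle, fun i => ?_⟩
    rw [Submodule.liftQ_apply, Fintype.linearCombination_apply_single, one_smul]
  · rintro ⟨φ, hφ⟩ r
    have hmem : R r ∈ equationModule R := Submodule.subset_span ⟨r, rfl⟩
    have hsum : ∑ j, R r j • (equationModule R).mkQ (Pi.single j 1) = 0 := by
      simp only [← map_smul, ← map_sum]
      rw [← pi_eq_sum_univ' (R r), Submodule.mkQ_apply, (Submodule.Quotient.mk_eq_zero _).mpr hmem]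
    simp only [← hφ, ← map_smul, ← map_sum]
    exact (congrArg φ hsum).trans φ.map_zero

/-! ### Equivalence of the two representations -/

/-- The equations of the latent variable representation, written out. -/
def LatentEquations (h : d ≤ n) (X : Matrix (Fin k) (Fin γ) (Laurent d))
    (F : Fin (n - d) → Matrix (Fin γ) (Fin γ) (Laurent d)) (C : Matrix (Fin w) (Fin γ) (Laurent d))
    (x : Traj n (Fin γ)) (u : Traj n (Fin w)) : Prop :=
  (∀ r, ∑ c, incl n d (X r c) • component x c = 0) ∧
  (∀ j c, shift (highIndex h j) • component x c = ∑ c', incl n d (F j c c') • component x c') ∧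
  ∀ i, component u i = ∑ c, incl n d (C i c) • component x c

theorem matAct_latentMatrix_eq_zero_iff (h : d ≤ n) (X : Matrix (Fin k) (Fin γ) (Laurent d))
    (F : Fin (n - d) → Matrix (Fin γ) (Fin γ) (Laurent d)) (C : Matrix (Fin w) (Fin γ) (Laurent d))
    (x : Traj n (Fin γ)) (u : Traj n (Fin w)) :
    matAct (latentMatrix h X F C) (stack x u) = 0 ↔ LatentEquations h X F C x u := by
  have hx : ∀ c, component (stack x u) (Sum.inl c) = component x c := fun _ => rfl
  have hu : ∀ i, component (stack x u) (Sum.inr i) = component u i := fun _ => rfl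
  rw [matAct_eq_zero_iff, LatentEquations]
  simp only [Sum.forall, Prod.forall, Fintype.sum_sum_type, hx, hu, latentMatrix,
    Matrix.fromRows_apply_inl, Matrix.fromRows_apply_inr, Matrix.fromCols_apply_inl,
    Matrix.fromCols_apply_inr, Matrix.zero_apply, zero_smul, Finset.sum_const_zero, add_zero,
    Matrix.map_apply, Matrix.of_apply, Matrix.sub_apply, sub_smul, Finset.sum_sub_distrib,
    Matrix.scalar_apply, Matrix.diagonal_apply, ite_smul, Finset.sum_ite_eq, Finset.mem_univ,
    if_true, Matrix.neg_apply, neg_smul, Finset.sum_neg_distrib, Matrix.one_apply, one_smul,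
    sub_eq_zero, neg_add_eq_zero]
  simp only [eq_comm (a := ∑ c, incl n d (C _ c) • component x c)]

/-- The point of `ℤⁿ` with the given first `d` and last `n - d` coordinates. -/
def combine (h : d ≤ n) (a : Fin d → ℤ) (b : Fin (n - d) → ℤ) : Fin n → ℤ := fun i =>
  if hi : (i : ℕ) < d then a ⟨i, hi⟩ else b ⟨i - d, by omega⟩

theorem lowPart_combine (h : d ≤ n) (a : Fin d → ℤ) (b : Fin (n - d) → ℤ) :
    lowPart h (combine h a b) = a := by
  ext i; simp [lowPart, combine]

theorem highPart_combine (h : d ≤ n) (a : Fin d → ℤ) (b : Fin (n - d) → ℤ) :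
    highPart h (combine h a b) = b := by
  ext i; simp [highPart, highIndex, combine]

theorem combine_lowPart_highPart (h : d ≤ n) (ν : Fin n → ℤ) :
    combine h (lowPart h ν) (highPart h ν) = ν := by
  ext i
  by_cases hi : (i : ℕ) < d
  · simp [combine, hi, lowPart]
  · simp only [combine, hi, dite_false, highPart, highIndex]
    congr 1
    ext
    simp
    omega

theorem toTraj_add_single (h : d ≤ n) {κ : Type} (x : (Fin (n - d) → ℤ) → Traj d κ)
    (j : Fin (n - d)) (ν : Fin n → ℤ) : toTraj h x (ν + Pi.single (highIndex h j) 1) =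
      x (highPart h ν + Pi.single j 1) (lowPart h ν) := by
  have h1 : highPart h (ν + Pi.single (highIndex h j) 1) = highPart h ν + Pi.single j 1 := by
    ext i
    by_cases hij : i = j
    · subst hij; simp [highPart]
    · have : highIndex h i ≠ highIndex h j := fun h' => hij (by
        simpa [highIndex, Fin.ext_iff] using h')
      simp [highPart, hij, this]
  have h2 : lowPart h (ν + Pi.single (highIndex h j) 1) = lowPart h ν := by
    ext i
    have : Fin.castLE h i ≠ highIndex h j := fun h' => by
      have := congrArg Fin.val h'
      simp [highIndex] at this
      omega
    simp [lowPart, this]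
  rw [toTraj, h1, h2]

/-- Shifts in the first d variables leave the last n - d coordinates fixed, so they act on each
slice separately. -/
theorem incl_smul_toTraj (h : d ≤ n) {κ : Type} (x : (Fin (n - d) → ℤ) → Traj d κ) (c : κ)
    (f : Laurent d) (ν : Fin n → ℤ) :
    (incl n d f • component (toTraj h x) c) ν =
      (f • component (x (highPart h ν)) c) (lowPart h ν) := by
  rw [incl, mapDomainRingHom_smul_apply, smul_eq_act]
  refine Finset.sum_congr rfl fun μ _ => ?_
  have h1 : highPart h (ν + extendZero n d μ) = highPart h ν := by
    ext i; simp [highPart, highIndex, extendZero]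
  have h2 : lowPart h (ν + extendZero n d μ) = lowPart h ν + μ := by
    ext i; simp [lowPart, extendZero]
  simp only [component, toTraj, h1, h2]

theorem sum_incl_smul_toTraj (h : d ≤ n) {κ ι : Type} [Fintype κ]
    (x : (Fin (n - d) → ℤ) → Traj d κ) (M : Matrix ι κ (Laurent d)) (i : ι) (ν : Fin n → ℤ) :
    (∑ c, incl n d (M i c) • component (toTraj h x) c) ν =
      matAct M (x (highPart h ν)) (lowPart h ν) i := by
  refine (Finset.sum_apply (M := fun _ => ℝ) ν _ _).trans (Finset.sum_congr rfl fun c _ => ?_)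
  rw [incl_smul_toTraj, smul_eq_act]
  rfl

theorem firstOrder_iff_latentEquations (h : d ≤ n) (X : Matrix (Fin k) (Fin γ) (Laurent d))
    (F : Fin (n - d) → Matrix (Fin γ) (Fin γ) (Laurent d)) (C : Matrix (Fin w) (Fin γ) (Laurent d))
    (x : (Fin (n - d) → ℤ) → Traj d (Fin γ)) (u : Traj n (Fin w)) :
    FirstOrder h X F C x u ↔ LatentEquations h X F C (toTraj h x) u := by
  refine and_congr ?_ (and_congr ?_ ?_)
  · constructor
    · intro hx r
      funext ν
      rw [sum_incl_smul_toTraj, show matAct X _ = 0 from hx _]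
      rfl
    · intro hx η
      funext a r
      have := congrFun (hx r) (combine h a η)
      rwa [sum_incl_smul_toTraj, lowPart_combine, highPart_combine] at this
  · have hshift : ∀ j c ν, (shift (highIndex h j) • component (toTraj h x) c) ν =
        x (highPart h ν + Pi.single j 1) (lowPart h ν) c := fun j c ν => by
      rw [shift, single_one_smul_apply]
      exact congrFun (toTraj_add_single h x j ν) c
    constructor
    · intro hx j c
      funext ν
      rw [hshift, sum_incl_smul_toTraj, hx]
    · intro hx j η
      funext a c
      have := congrFun (hx j c) (combine h a η)
      rwa [hshift, sum_incl_smul_toTraj, lowPart_combine, highPart_combine] at this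
  · constructor
    · rintro rfl i
      funext ν
      rw [sum_incl_smul_toTraj]
      rfl
    · intro hx
      funext ν i
      exact (congrFun (hx i) ν).trans (sum_incl_smul_toTraj h x C i ν)

theorem toTraj_surjective (h : d ≤ n) {κ : Type} :
    Function.Surjective (toTraj h : _ → Traj n κ) := fun x =>
  ⟨fun η a => x (combine h a η), funext fun ν => congrArg x (combine_lowPart_highPart h ν)⟩

/-! ### Coordinate changes and assembly -/

/-- A unimodular matrix inducing a given automorphism of `ℤⁿ`. -/
theorem exists_unimodular_mulVec_eq (U : (Fin n → ℤ) ≃+ (Fin n → ℤ)) :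
    ∃ T : Matrix (Fin n) (Fin n) ℤ, (T.det = 1 ∨ T.det = -1) ∧ ∀ ν, T.mulVec ν = U ν := by
  let L : (Fin n → ℤ) ≃ₗ[ℤ] (Fin n → ℤ) := U.toIntLinearEquiv
  refine ⟨LinearMap.toMatrix' L.toLinearMap, ?_, fun ν => LinearMap.toMatrix'_mulVec _ _⟩
  rw [← Int.isUnit_iff, LinearMap.det_toMatrix']
  exact L.isUnit_det'

theorem subalgebra_eq_top_of_shift_mem (h : d ≤ n) (U : (Fin n → ℤ) ≃+ (Fin n → ℤ))
    [Algebra (Laurent d) (Laurent n)]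
    (hψ : algebraMap (Laurent d) (Laurent n) = AddMonoidAlgebra.mapDomainRingHom ℝ
      (U.toAddMonoidHom.comp (extendZero n d)))
    (S : Subalgebra (Laurent d) (Laurent n))
    (h1 : ∀ j, AddMonoidAlgebra.single (U (Pi.single (highIndex h j) 1)) 1 ∈ S)
    (h2 : ∀ j (a : Laurent n),
      a * AddMonoidAlgebra.single (U (Pi.single (highIndex h j) 1)) 1 = 1 → a ∈ S) :
    S = ⊤ := by
  have hD : ∀ (a : Fin d → ℤ) (r : ℝ), AddMonoidAlgebra.single (U (extendZero n d a)) r ∈ S :=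
    fun a r => by
      have := S.algebraMap_mem (AddMonoidAlgebra.single a r)
      rw [hψ, AddMonoidAlgebra.mapDomainRingHom_apply, AddMonoidAlgebra.mapDomain_single] at this
      exact this
  -- The exponents whose monomials lie in S are closed under addition. They contain the first d axes
  -- through the scalars, and the other axes in both directions through `h1` and `h2`.
  let H : AddSubmonoid (Fin n → ℤ) :=
    { carrier := {ν | AddMonoidAlgebra.single (U ν) 1 ∈ S}
      zero_mem' := by
        rw [Set.mem_ofPred_eq, map_zero]
        exact S.one_mem
      add_mem' := fun {a b} ha hb => by
        have := S.mul_mem ha hb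
        rw [AddMonoidAlgebra.single_mul_single, ← map_add, one_mul] at this
        exact this }
  have hH : ∀ ν, ν ∈ H := fun ν => by
    rw [← Finset.univ_sum_single ν]
    refine H.sum_mem fun i _ => ?_
    by_cases hi : (i : ℕ) < d
    · have : (Pi.single i (ν i) : Fin n → ℤ) = extendZero n d (Pi.single ⟨i, hi⟩ (ν i)) := by
        ext l
        by_cases hl : l = i
        · subst hl; simp [extendZero, hi]
        · simp [extendZero, hl, Fin.ext_iff, Fin.val_inj]
      rw [this]
      exact hD _ _
    · obtain ⟨j, rfl⟩ : ∃ j, highIndex h j = i :=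
        ⟨⟨i - d, by omega⟩, Fin.ext (by simp [highIndex]; omega)⟩
      have hpos : Pi.single (highIndex h j) 1 ∈ H := h1 j
      have hneg : Pi.single (highIndex h j) (-1) ∈ H := h2 j _ (by
        rw [AddMonoidAlgebra.single_mul_single, ← map_add, ← Pi.single_add]
        simp; rfl)
      obtain ⟨m, hm | hm⟩ := (ν (highIndex h j)).eq_nat_or_neg
      · have := H.nsmul_mem hpos m
        rwa [← Pi.single_smul, nsmul_one, ← hm] at this
      · have := H.nsmul_mem hneg m
        rwa [← Pi.single_smul, nsmul_eq_mul, mul_neg_one, ← hm] at this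
  refine eq_top_iff.mpr fun a _ => ?_
  induction a using AddMonoidAlgebra.induction_linear with
  | zero => exact S.zero_mem
  | add a b ha hb => exact S.add_mem (ha trivial) (hb trivial)
  | single μ r =>
    have h3 := S.mul_mem (hD 0 r) (hH (U.symm μ))
    rw [AddMonoidAlgebra.single_mul_single] at h3
    simpa using h3

/-- If the quotient of the ring of shift operators by the annihilator of the quotient module is
integral over the first `d` shifts, after a coordinate change, then the behavior has a
latent-variable representation over the first `d` shifts. -/
theorem exists_latentEquations (h : d ≤ n) (R : Matrix (Fin k) (Fin w) (Laurent n))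
    (U : (Fin n → ℤ) ≃+ (Fin n → ℤ))
    (hU : ((Ideal.Quotient.mk (Module.annihilator (Laurent n) (QuotientModule R))).comp
      (AddMonoidAlgebra.mapDomainRingHom ℝ
        (U.toAddMonoidHom.comp (extendZero n d)))).IsIntegral) :
    ∃ (γ l : ℕ) (X : Matrix (Fin l) (Fin γ) (Laurent d))
      (F : Fin (n - d) → Matrix (Fin γ) (Fin γ) (Laurent d))
      (C : Matrix (Fin w) (Fin γ) (Laurent d)), 0 < γ ∧ ∀ v : Traj n (Fin w),
        v ∈ behavior R ↔ ∃ x, LatentEquations h X F C x fun ν => v (U ν) := by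
  set ψ := AddMonoidAlgebra.mapDomainRingHom ℝ (U.toAddMonoidHom.comp (extendZero n d))
  -- `Laurent d` acts through the embedding twisted by U, over which M is finite; composing
  -- trajectories with U (`pull` below) turns this into the action through `incl`.
  let : Algebra (Laurent d) (Laurent n) := ψ.toAlgebra
  have : IsScalarTower ℝ (Laurent d) (Laurent n) := IsScalarTower.of_algebraMap_eq fun r => by
    change AddMonoidAlgebra.single 0 r = AddMonoidAlgebra.mapDomain _ (AddMonoidAlgebra.single 0 r)
    rw [AddMonoidAlgebra.mapDomain_single, map_zero]
  have : Algebra.FiniteType (Laurent d) (Laurent n) :=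
    Algebra.FiniteType.of_restrictScalars_finiteType ℝ _ _
  have : Module.Finite (Laurent d) (QuotientModule R) :=
    finite_of_isIntegral_quotient_annihilator hU
  have : IsNoetherianRing (Laurent d) := Algebra.FiniteType.isNoetherianRing ℝ _
  let : Module (Laurent d) (ScalarTraj n) := Module.compHom _ ψ
  have : IsScalarTower (Laurent d) (Laurent n) (ScalarTraj n) :=
    ⟨fun a b v => mul_smul (ψ a) b v⟩
  obtain ⟨γ, l, X, F, C, hγ, H⟩ := exists_firstOrder_representation (D := Laurent d)
    (V := ScalarTraj n)
    (fun j => (AddMonoidAlgebra.single (U (Pi.single (highIndex h j) 1)) 1 : Laurent n))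
    (subalgebra_eq_top_of_shift_mem h U rfl)
    (fun i : Fin w => (Submodule.Quotient.mk (Pi.single i 1) : QuotientModule R))
  refine ⟨γ, l, X, F, C, hγ, fun v => ?_⟩
  rw [mem_behavior_iff_exists_linearMap, H]
  let pull : ScalarTraj n → ScalarTraj n := fun y ν => y (U ν)
  have hsmul : ∀ (f : Laurent d) (y : ScalarTraj n) (ν : Fin n → ℤ),
      (f • y) (U ν) = (incl n d f • pull y) ν :=
    fun f y ν => by
      change (ψ f • y) (U ν) = _
      rw [incl, mapDomainRingHom_smul_apply, mapDomainRingHom_smul_apply]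
      refine Finset.sum_congr rfl fun μ _ => ?_
      change _ = _ * y (U (ν + _))
      rw [map_add]
      rfl
  have hsum : ∀ (f : Fin γ → Laurent d) (y : Fin γ → ScalarTraj n) (ν : Fin n → ℤ),
      (∑ c, f c • y c) (U ν) =
        (∑ c, incl n d (f c) • pull (y c)) ν :=
    fun f y ν => by
      refine (Finset.sum_apply (M := fun _ => ℝ) (U ν) _ _).trans
        (Eq.trans ?_ (Finset.sum_apply (M := fun _ => ℝ) ν _ _).symm)
      exact Finset.sum_congr rfl fun c _ => hsmul _ _ _
  have hz : ∀ (j : Fin (n - d)) (y : ScalarTraj n) (ν : Fin n → ℤ),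
      ((AddMonoidAlgebra.single (U (Pi.single (highIndex h j) 1)) 1 : Laurent n) • y) (U ν) =
        (shift (highIndex h j) • pull y) ν := fun j y ν => by
    rw [shift, single_one_smul_apply, single_one_smul_apply, ← map_add]
  have hext : ∀ y y' : ScalarTraj n, y = y' ↔ ∀ ν, y (U ν) = y' (U ν) := fun y y' =>
    funext_iff.trans U.surjective.forall
  have key : ∀ y : Fin γ → ScalarTraj n,
      ((∀ r, ∑ c, X r c • y c = 0) ∧
        (∀ j c, (AddMonoidAlgebra.single (U (Pi.single (highIndex h j) 1)) 1 : Laurent n) • y c =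
          ∑ c', F j c c' • y c') ∧ ∀ i, component v i = ∑ c, C i c • y c) ↔
      LatentEquations h X F C (fun ν c => y c (U ν)) fun ν => v (U ν) := fun y => by
    refine and_congr (forall_congr' fun r => ?_) (and_congr
      (forall_congr' fun j => forall_congr' fun c => ?_) (forall_congr' fun i => ?_)) <;>
    refine (hext _ _).trans ((forall_congr' fun ν => ?_).trans funext_iff.symm)
    · rw [hsum]; rfl
    · rw [hsum, hz]; rfl
    · rw [hsum]; rfl
  simp only [key]
  constructor
  · rintro ⟨y, hy⟩
    exact ⟨_, hy⟩
  · rintro ⟨x, hx⟩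
    refine ⟨fun c ν => x (U.symm ν) c, ?_⟩
    simpa using hx

end NDSystem

open NDSystem
theorem mainTheorem5 (n w m d : ℕ) (R : Matrix (Fin m) (Fin w) (Laurent n))
    (B : Set (Traj n (Fin w))) (hB : B = behavior R) (haut : IsAutonomous R)
    (hd : ringKrullDim (AnnihilatorQuotient R) = (d : WithBot ℕ∞) ∨
      (Subsingleton (QuotientModule R) ∧ d = 0)) :
    ∃ hdn : d ≤ n, ∃ T : Matrix (Fin n) (Fin n) ℤ, (T.det = 1 ∨ T.det = -1) ∧
      ∃ (γ k : ℕ) (X : Matrix (Fin k) (Fin γ) (Laurent d))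
        (A : Fin (n - d) → Matrix (Fin γ) (Fin γ) (Laurent d))
        (C : Matrix (Fin w) (Fin γ) (Laurent d)),
        0 < γ ∧
        B = {v | ∃ (x : (Fin (n - d) → ℤ) → Traj d (Fin γ)) (u : Traj n (Fin w)),
          FirstOrder hdn X A C x u ∧ v = pullback T u} ∧
        B = {v | ∃ (x : Traj n (Fin γ)) (u : Traj n (Fin w)),
          matAct (latentMatrix hdn X A C) (stack x u) = 0 ∧ v = pullback T u} := by
  obtain ⟨hdn, U, hU⟩ : ∃ _ : d ≤ n, ∃ U : (Fin n → ℤ) ≃+ (Fin n → ℤ),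
      ((Ideal.Quotient.mk (Module.annihilator (Laurent n) (QuotientModule R))).comp
        (AddMonoidAlgebra.mapDomainRingHom ℝ
          (U.toAddMonoidHom.comp (extendZero n d)))).IsIntegral := by
    rcases hd with hd | ⟨hM, rfl⟩
    · have : Nontrivial (AnnihilatorQuotient R) := by
        by_contra hS
        rw [not_nontrivial_iff_subsingleton] at hS
        rw [ringKrullDim_eq_bot_of_subsingleton] at hd
        exact absurd hd (WithBot.bot_ne_coe)
      obtain ⟨d', hd', U, hint, hinj⟩ := exists_noether_normalization
        (Ideal.Quotient.mk (Module.annihilator (Laurent n) (QuotientModule R)))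
        (RingHom.isIntegral_of_surjective _ Ideal.Quotient.mk_surjective)
      have hdim := ringKrullDim_eq_of_isIntegral _ hint hinj
      rw [ringKrullDim_laurent] at hdim
      -- The normalization produces its own d'; the dimension count identifies it with d.
      obtain rfl : d = d' := by exact_mod_cast hd.symm.trans hdim
      exact ⟨hd', U, hint⟩
    -- When the quotient module vanishes, the target is the zero ring, and any ring map into it is
    -- integral, so d = 0 works.
    · have : Subsingleton (AnnihilatorQuotient R) := by
        rw [Ideal.Quotient.subsingleton_iff, Module.annihilator_eq_top_iff]
        exact hM
      refine ⟨n.zero_le, AddEquiv.refl _, fun s => ?_⟩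
      rw [Subsingleton.elim s 0]
      exact RingHom.isIntegralElem_zero _
  -- T represents the inverse of U, since u = v ∘ U amounts to v = u ∘ T.
  obtain ⟨T, hT, hTU⟩ := exists_unimodular_mulVec_eq U.symm
  obtain ⟨γ, k, X, F, C, hγ, H⟩ := exists_latentEquations hdn R U hU
  have hpull : ∀ v u : Traj n (Fin w), v = pullback T u ↔ u = fun ν => v (U ν) := fun v u => by
    constructor
    · rintro rfl
      funext ν
      simp [pullback, hTU]
    · rintro rfl
      funext ν
      simp [pullback, hTU]
  refine ⟨hdn, T, hT, γ, k, X, F, C, hγ, ?_, ?_⟩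
  · ext v
    simp only [hB, H, Set.mem_ofPred_eq, hpull, exists_eq_right, firstOrder_iff_latentEquations]
    exact (toTraj_surjective hdn).exists
  · ext v
    simp only [hB, H, Set.mem_ofPred_eq, hpull, exists_eq_right, matAct_latentMatrix_eq_zero_iff]
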